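/- Let $H_R$ be the Hopf algebra of rooted trees over $\mathbb{C}$: the polynomial algebra generated by the (unordered) rooted trees, so that forests form a basis, with the coproduct determined as an algebra morphism by $\Delta\circ B_+=B_+\otimes 1+(\mathrm{id}\otimes B_+)\circ\Delta$, where $B_+$ joins the roots of a forest to a new root; let $S$ be its antipode and $\star$ the convolution product. Let $f:[0,\infty)\to\mathbb{C}$ be continuous with $f(\zeta)=\frac{c}{\zeta}+O(\zeta^{-1-\varepsilon})$ for $\zeta\to\infty$, for some $c\in\mathbb{C}$ and $\varepsilon>0$ (for example $f(\zeta)=\frac{1}{1+\zeta}$). The analytically regularized Feynman rules of the toy model are the algebra morphism $\phi$ from $H_R$ to functions of the regulator $z$ and the scale $s>0$ given by $$\phi_s(B_+(x))=\int_0^\infty f(\zeta)\,(s\zeta)^{-z}\,\phi_{s\zeta}(x)\,d\zeta\qquad\text{for every forest }x .$$ For a subtraction point $\rho>0$, the momentum scheme is evaluation at $s=\rho$; it gives the counterterm $\phi_\rho\circ S$ and the renormalized Feynman rules $\phi_{R,s}=(\phi_\rho\circ S)\star\phi_s$. Then: 1. For every $x\in H_R$ the integral $\int_0^\infty f(\zeta)(s\zeta)^{-z}\phi_{s\zeta}(x)\,d\zeta$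 converges absolutely for all $s>0$ and all $z$ sufficiently close to $0$ with $\operatorname{Re}z>0$. 2. The physical limit exists and takes values in the polynomials in $\ln\frac{s}{\rho}$: there is a linear map $\Phi:H_R\to\mathbb{C}[X]$ (not depending on $s$ and $\rho$) such that for all $x\in H_R$ and $s,\rho>0$ $$\lim_{z\to 0,\ \operatorname{Re}z>0}\phi_{R,s}(x)=\Phi(x)\!\left(\ln\tfrac{s}{\rho}\right).$$ Moreover $z\mapsto\phi_{R,s}(x)$ extends from small $z$ with $\operatorname{Re}z>0$ to a function that is holomorphic at $z=0$. -/

import Mathlib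

open MeasureTheory Filter Topology Set
open scoped TensorProduct

noncomputable section

/-! ### Rooted trees -/

/-- Ordered (planar) rooted trees: a root together with the list of its branches. -/
inductive PlanarTree : Type
  | node : List PlanarTree → PlanarTree

namespace PlanarTree

/-- Equality of planar trees up to the order of the branches at every node: the smallest
equivalence relation that permutes the branches of a root and that is compatible with replacing a
branch by an equivalent one. -/
inductive Iso : PlanarTree → PlanarTree → Prop
  | refl (t : PlanarTree) : Iso t t
  | symm {t u : PlanarTree} : Iso t u → Iso u t
  | trans {t u v : PlanarTree} : Iso t u → Iso u v → Iso t v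
  | perm {l l' : List PlanarTree} : l.Perm l' → Iso (node l) (node l')
  | branch {t u : PlanarTree} (l : List PlanarTree) :
      Iso t u → Iso (node (t :: l)) (node (u :: l))

instance setoid : Setoid PlanarTree := ⟨Iso, ⟨Iso.refl, Iso.symm, Iso.trans⟩⟩

theorem Iso.node_append {l l' : List PlanarTree} (h : List.Forall₂ Iso l l') :
    ∀ p : List PlanarTree, Iso (node (l ++ p)) (node (l' ++ p)) := by
  induction h with
  | nil => exact fun p => Iso.refl _
  | @cons a b l l' hab _ ih =>
    intro p
    refine (Iso.branch (l ++ p) hab).trans ?_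
    refine (Iso.perm (l' := l ++ (b :: p)) List.perm_middle.symm).trans ?_
    exact (ih (b :: p)).trans (Iso.perm List.perm_middle)

theorem Iso.node {l l' : List PlanarTree} (h : List.Forall₂ Iso l l') :
    Iso (node l) (node l') := by
  simpa using Iso.node_append h []

end PlanarTree

/-- (Unordered) rooted trees. A forest is a multiset of rooted trees. -/
def RTree : Type := Quotient PlanarTree.setoid

namespace RTree

/-- The rooted tree underlying a planar one. -/
def mk (t : PlanarTree) : RTree := Quotient.mk _ t

/-- A planar representative of a rooted tree. -/
def out (t : RTree) : PlanarTree := Quotient.out (s := PlanarTree.setoid) t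

theorem mk_out (t : RTree) : mk t.out = t := Quotient.out_eq (s := PlanarTree.setoid) t

theorem out_mk (t : PlanarTree) : PlanarTree.Iso (mk t).out t :=
  Quotient.mk_out (s := PlanarTree.setoid) t

/-- The tree that arises from a forest by joining all its roots to a new root. -/
def node (m : Multiset RTree) : RTree :=
  Quot.liftOn m (fun l => mk (.node (l.map out)))
    (fun _ _ h => Quotient.sound (PlanarTree.Iso.perm (List.Perm.map _ h)))

theorem node_mk (l : List PlanarTree) :
    node ((l.map mk : List RTree) : Multiset RTree) = mk (.node l) := by
  refine Quotient.sound (PlanarTree.Iso.node ?_)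
  rw [List.map_map, List.forall₂_map_left_iff, List.forall₂_same]
  exact fun t _ => out_mk t

/-- Induction on rooted trees. -/
theorem induction {P : RTree → Prop} (h : ∀ m : Multiset RTree, (∀ t ∈ m, P t) → P (node m))
    (t : RTree) : P t := by
  induction t using Quotient.inductionOn with
  | h t =>
    have key : ∀ t : PlanarTree, P (mk t) := by
      refine PlanarTree.rec (motive_1 := fun t => P (mk t))
        (motive_2 := fun l => ∀ t ∈ l, P (mk t)) (fun l ih => ?_)
        (fun _ ht => absurd ht List.not_mem_nil) (fun a l ha hl => List.forall_mem_cons.2 ⟨ha, hl⟩)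
      rw [← node_mk]
      apply h
      intro t ht
      obtain ⟨u, hu, rfl⟩ := List.mem_map.1 (Multiset.mem_coe.1 ht)
      exact ih u hu
    exact key t

theorem map_mk_eq_of_iso {t u : PlanarTree} (h : PlanarTree.Iso t u) :
    ∀ l l' : List PlanarTree, t = .node l → u = .node l' →
      ((l.map mk : List RTree) : Multiset RTree) = (l'.map mk : List RTree) := by
  induction h with
  | refl t =>
    rintro l l' rfl h
    cases h
    rfl
  | symm _ ih => exact fun l l' h h' => (ih l' l h' h).symm
  | @trans t u v _ _ ih ih' =>
    obtain ⟨k⟩ := u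
    exact fun l l' h h' => (ih l k h rfl).trans (ih' k l' rfl h')
  | perm h =>
    rintro l l' h1 h2
    cases h1
    cases h2
    exact Multiset.coe_eq_coe.2 (h.map _)
  | branch l h =>
    rintro l l' h1 h2
    cases h1
    cases h2
    rw [List.map_cons, List.map_cons, show mk _ = mk _ from Quotient.sound h]

/-- Forests correspond to trees by joining the roots to a new root. -/
theorem node_bijective : Function.Bijective node := by
  have hl : ∀ m : Multiset RTree,
      ∃ l : List PlanarTree, m = ((l.map mk : List RTree) : Multiset RTree) := fun m => by
    induction m using Quotient.inductionOn with
    | h l =>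
      refine ⟨l.map out, ?_⟩
      rw [List.map_map, show mk ∘ out = id from funext mk_out, List.map_id]
      rfl
  refine ⟨fun m m' h => ?_, fun t => ?_⟩
  · obtain ⟨l, rfl⟩ := hl m
    obtain ⟨l', rfl⟩ := hl m'
    rw [node_mk, node_mk] at h
    exact map_mk_eq_of_iso (Quotient.exact h) l l' rfl rfl
  · obtain ⟨⟨l⟩, rfl⟩ : ∃ p, mk p = t := ⟨t.out, mk_out t⟩
    exact ⟨_, node_mk l⟩

variable {A : Type*} [CommMonoid A]

/-- Recursion on planar trees; see `RTree.fold`. -/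
def planarFold (G : RTree → A → A) : PlanarTree → A
  | .node l => G (mk (.node l)) (l.map (fun t => planarFold G t)).prod

theorem planarFold_iso (G : RTree → A → A) {t u : PlanarTree} (h : PlanarTree.Iso t u) :
    planarFold G t = planarFold G u := by
  induction h with
  | refl => rfl
  | symm _ ih => exact ih.symm
  | trans _ _ ih ih' => exact ih.trans ih'
  | @perm l l' h =>
    rw [planarFold, planarFold, (h.map _).prod_eq,
      show mk (.node l) = mk (.node l') from Quotient.sound (PlanarTree.Iso.perm h)]
  | @branch t u l h ih =>
    rw [planarFold, planarFold, List.map_cons, List.map_cons, ih,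
      show mk (.node (t :: l)) = mk (.node (u :: l)) from
        Quotient.sound (PlanarTree.Iso.branch l h)]

/-- The function on rooted trees with values in a commutative monoid that is given recursively by
`fold G (node m) = G (node m) (∏ t ∈ m, fold G t)`. -/
def fold (G : RTree → A → A) (t : RTree) : A :=
  Quotient.liftOn t (planarFold G) (fun _ _ h => planarFold_iso G h)

theorem fold_node (G : RTree → A → A) (m : Multiset RTree) :
    fold G (node m) = G (node m) (m.map (fold G)).prod := by
  obtain ⟨l, rfl⟩ : ∃ l : List PlanarTree, m = ((l.map mk : List RTree) : Multiset _) := by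
    induction m using Quotient.inductionOn with
    | h l =>
      refine ⟨l.map out, ?_⟩
      rw [List.map_map, show mk ∘ out = id from funext mk_out, List.map_id]
      rfl
  rw [node_mk]
  change planarFold G (.node l) = _
  rw [planarFold, Multiset.map_coe, Multiset.prod_coe, List.map_map]
  rfl

end RTree

/-! ### The Hopf algebra of rooted trees -/

/-- The algebra `H_R` of rooted trees over `K`: the polynomial algebra generated by the rooted
trees. The monomials are the forests. -/
def HR (K : Type*) [CommRing K] : Type _ := MvPolynomial RTree K

namespace HR

open Algebra

variable (K : Type*) [CommRing K]

instance instCommRing : CommRing (HR K) := inferInstanceAs (CommRing (MvPolynomial RTree K))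

instance instAlgebra : Algebra K (HR K) := inferInstanceAs (Algebra K (MvPolynomial RTree K))

/-- A rooted tree as an element of `H_R`. -/
def tree (t : RTree) : HR K := (MvPolynomial.X t : MvPolynomial RTree K)

/-- A forest as an element of `H_R`: the product of its trees. -/
def forest (m : Multiset RTree) : HR K := (m.map (tree K)).prod

/-- The basis of `H_R` that consists of the forests. -/
def forestBasis : Module.Basis (RTree →₀ ℕ) K (HR K) :=
  MvPolynomial.basisMonomials RTree K

theorem forestBasis_apply (d : RTree →₀ ℕ) :
    forestBasis K d = forest K (Finsupp.toMultiset d) := by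
  have h : MvPolynomial.basisMonomials RTree K d =
      ((Finsupp.toMultiset d).map (MvPolynomial.X (R := K))).prod := by
    rw [MvPolynomial.coe_basisMonomials]
    simp only [MvPolynomial.monomial_eq]
    rw [Finsupp.toMultiset_map, Finsupp.prod_toMultiset,
      Finsupp.prod_mapDomain_index (fun _ => pow_zero _) (fun _ _ _ => pow_add _ _ _)]
    simp
  exact h

/-- The grafting operator `B₊`: the linear map that sends a forest to the tree obtained by joining
its roots to a new root. -/
def graft : HR K →ₗ[K] HR K :=
  (forestBasis K).constr K (fun d => tree K (RTree.node (Finsupp.toMultiset d)))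

theorem graft_forest (m : Multiset RTree) :
    graft K (forest K m) = tree K (RTree.node m) := by
  classical
  have h := (forestBasis K).constr_basis K
    (fun d => tree K (RTree.node (Finsupp.toMultiset d))) (Multiset.toFinsupp m)
  rw [forestBasis_apply, Multiset.toFinsupp_toMultiset] at h
  exact h

variable {K}

/-- The algebra morphism on `H_R` with prescribed values on the trees. -/
def lift {A : Type*} [CommRing A] [Algebra K A] (v : RTree → A) : HR K →ₐ[K] A :=
  MvPolynomial.aeval (R := K) v

section lift

variable {A : Type*} [CommRing A] [Algebra K A]

theorem lift_tree (v : RTree → A) (t : RTree) : lift v (tree K t) = v t :=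
  MvPolynomial.aeval_X _ _

theorem map_forest (φ : HR K →ₐ[K] A) (m : Multiset RTree) :
    φ (forest K m) = (m.map (fun t => φ (tree K t))).prod := by
  rw [forest, map_multiset_prod, Multiset.map_map]
  rfl

theorem lift_forest (v : RTree → A) (m : Multiset RTree) :
    lift v (forest K m) = (m.map v).prod := by
  simp only [map_forest, lift_tree]

/-- Linear maps that agree on all forests are equal. -/
theorem linearMap_ext {M : Type*} [AddCommMonoid M] [Module K M] {f g : HR K →ₗ[K] M}
    (h : ∀ m, f (forest K m) = g (forest K m)) : f = g :=
  (forestBasis K).ext fun d => by rw [forestBasis_apply]; exact h _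

/-- Algebra morphisms on `H_R` are equal as soon as agreement on a forest `x` always implies
agreement on the tree `B₊(x)`. -/
theorem algHom_ext {φ ψ : HR K →ₐ[K] A}
    (h : ∀ m, φ (forest K m) = ψ (forest K m) →
      φ (graft K (forest K m)) = ψ (graft K (forest K m))) : φ = ψ := by
  have key : ∀ t, φ (tree K t) = ψ (tree K t) := fun t => by
    induction t using RTree.induction with
    | h m ih =>
      rw [← graft_forest]
      apply h
      rw [map_forest, map_forest, Multiset.map_congr rfl ih]
  exact MvPolynomial.algHom_ext (R := K) (σ := RTree) (f := φ) (g := ψ) key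

theorem lift_graft_forest (G : RTree → A → A) (m : Multiset RTree) :
    lift (RTree.fold G) (graft K (forest K m)) =
      G (RTree.node m) (lift (RTree.fold G) (forest K m)) := by
  rw [graft_forest, lift_tree, RTree.fold_node, lift_forest]

end lift

variable (K)

/-- The coproduct of `H_R`: the algebra morphism such that
`Δ ∘ B₊ = B₊ ⊗ 1 + (id ⊗ B₊) ∘ Δ`. -/
def coproduct : HR K →ₐ[K] HR K ⊗[K] HR K :=
  lift (RTree.fold fun t a => tree K t ⊗ₜ[K] 1 + (graft K).lTensor (HR K) a)

theorem coproduct_graft (x : HR K) :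
    coproduct K (graft K x) = graft K x ⊗ₜ[K] 1 + (graft K).lTensor (HR K) (coproduct K x) := by
  have : (coproduct K).toLinearMap ∘ₗ graft K =
      (TensorProduct.mk K (HR K) (HR K)).flip 1 ∘ₗ graft K +
        (graft K).lTensor (HR K) ∘ₗ (coproduct K).toLinearMap := by
    refine linearMap_ext fun m => ?_
    simp only [LinearMap.comp_apply, LinearMap.add_apply, AlgHom.toLinearMap_apply,
      LinearMap.flip_apply, TensorProduct.mk_apply]
    rw [coproduct, lift_graft_forest, graft_forest]
  exact LinearMap.congr_fun this x

/-- The counit of `H_R`: it maps the empty forest to `1` and every other forest to `0`. -/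
def counitHom : HR K →ₐ[K] K := lift (fun _ => 0)

theorem counitHom_graft (x : HR K) : counitHom K (graft K x) = 0 := by
  have : (counitHom K).toLinearMap ∘ₗ graft K = 0 := by
    refine linearMap_ext fun m => ?_
    simp only [LinearMap.comp_apply, AlgHom.toLinearMap_apply, LinearMap.zero_apply]
    rw [graft_forest, counitHom, lift_tree]
  exact LinearMap.congr_fun this x

/-- The bialgebra `H_R`. -/
instance instBialgebra : Bialgebra K (HR K) :=
  Bialgebra.ofAlgHom (coproduct K) (counitHom K)
    (by
      refine algHom_ext fun m ih => ?_
      simp only [AlgHom.comp_apply] at ih ⊢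
      have h1 : ∀ y : HR K ⊗[K] HR K, Algebra.TensorProduct.map (coproduct K) (.id K (HR K))
          ((graft K).lTensor (HR K) y) = (graft K).lTensor _
            (Algebra.TensorProduct.map (coproduct K) (.id K (HR K)) y) := fun y => by
        induction y with
        | zero => simp
        | add a b ha hb => simp only [map_add, ha, hb]
        | tmul a b => simp
      have h2 : ∀ y : (HR K ⊗[K] HR K) ⊗[K] HR K,
          (Algebra.TensorProduct.assoc K K K (HR K) (HR K) (HR K)).toAlgHom
          ((graft K).lTensor _ y) = ((graft K).lTensor (HR K)).lTensor (HR K)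
            ((Algebra.TensorProduct.assoc K K K (HR K) (HR K) (HR K)).toAlgHom y) := fun y => by
        induction y with
        | zero => simp
        | add a b ha hb => simp only [map_add, ha, hb]
        | tmul a b =>
          induction a with
          | zero => simp
          | add a b ha hb => simp only [TensorProduct.add_tmul, map_add, ha, hb]
          | tmul a c => simp
      have h3 : ∀ y : HR K ⊗[K] HR K, Algebra.TensorProduct.map (.id K (HR K)) (coproduct K)
          ((graft K).lTensor (HR K) y) =
            (Algebra.TensorProduct.assoc K K K (HR K) (HR K) (HR K)).toAlgHom
            ((graft K).lTensor (HR K) y ⊗ₜ[K] 1) + ((graft K).lTensor (HR K)).lTensor (HR K)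
            (Algebra.TensorProduct.map (.id K (HR K)) (coproduct K) y) := fun y => by
        induction y with
        | zero => simp
        | add a b ha hb =>
          simp only [map_add, ha, hb, TensorProduct.add_tmul]
          abel
        | tmul a b => simp [coproduct_graft, TensorProduct.tmul_add]
      rw [coproduct_graft, map_add, map_add, map_add, h1, h2, h3, ih]
      simp [coproduct_graft, TensorProduct.add_tmul, TensorProduct.one_def]
      abel)
    (by
      refine algHom_ext fun m ih => ?_
      simp only [AlgHom.comp_apply] at ih ⊢
      have h1 : ∀ y : HR K ⊗[K] HR K, Algebra.TensorProduct.map (counitHom K) (.id K (HR K))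
          ((graft K).lTensor (HR K) y) = (graft K).lTensor _
            (Algebra.TensorProduct.map (counitHom K) (.id K (HR K)) y) := fun y => by
        induction y with
        | zero => simp
        | add a b ha hb => simp only [map_add, ha, hb]
        | tmul a b => simp
      rw [coproduct_graft, map_add, h1, ih]
      simp [counitHom_graft])
    (by
      refine algHom_ext fun m ih => ?_
      simp only [AlgHom.comp_apply] at ih ⊢
      have h1 : ∀ y : HR K ⊗[K] HR K, Algebra.TensorProduct.map (.id K (HR K)) (counitHom K)
          ((graft K).lTensor (HR K) y) = 0 := fun y => by
        induction y with
        | zero => simp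
        | add a b ha hb => simp only [map_add, ha, hb, add_zero]
        | tmul a b => simp [counitHom_graft]
      rw [coproduct_graft, map_add, h1]
      simp)

theorem comul_graft (x : HR K) :
    Coalgebra.comul (R := K) (graft K x) =
      graft K x ⊗ₜ[K] 1 + (graft K).lTensor (HR K) (Coalgebra.comul x) :=
  coproduct_graft K x

/-- The algebra morphism `(S ⊗ id) ∘ Δ`, where `S` is the antipode, computed recursively from
`S ∘ B₊ = - m ∘ (S ⊗ B₊) ∘ Δ`. -/
def antipodeAux : HR K →ₐ[K] HR K ⊗[K] HR K :=
  lift (RTree.fold fun _ a => (graft K).lTensor (HR K) a -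
    (LinearMap.mul' K (HR K) ((graft K).lTensor (HR K) a)) ⊗ₜ[K] 1)

/-- The antipode of `H_R`, as an algebra morphism. -/
def antipodeHom : HR K →ₐ[K] HR K :=
  ((Algebra.TensorProduct.rid K K (HR K)).toAlgHom.comp
    (Algebra.TensorProduct.map (.id K (HR K)) (counitHom K))).comp (antipodeAux K)

theorem antipodeAux_graft_forest (m : Multiset RTree) :
    antipodeAux K (graft K (forest K m)) =
      (graft K).lTensor (HR K) (antipodeAux K (forest K m)) -
      (LinearMap.mul' K (HR K) ((graft K).lTensor (HR K) (antipodeAux K (forest K m)))) ⊗ₜ[K] 1 :=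
  lift_graft_forest _ m

theorem map_id_counitHom_graft (y : HR K ⊗[K] HR K) :
    Algebra.TensorProduct.map (.id K (HR K)) (counitHom K) ((graft K).lTensor (HR K) y) = 0 := by
  induction y with
  | zero => simp
  | add a b ha hb => simp only [map_add, ha, hb, add_zero]
  | tmul a b => simp [counitHom_graft]

theorem antipodeAux_eq : antipodeAux K =
    (Algebra.TensorProduct.map (antipodeHom K) (.id K (HR K))).comp (coproduct K) := by
  refine algHom_ext fun m ih => ?_
  simp only [AlgHom.comp_apply] at ih ⊢
  have h1 : ∀ y : HR K ⊗[K] HR K, Algebra.TensorProduct.map (antipodeHom K) (.id K (HR K))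
      ((graft K).lTensor (HR K) y) = (graft K).lTensor _
        (Algebra.TensorProduct.map (antipodeHom K) (.id K (HR K)) y) := fun y => by
    induction y with
    | zero => simp
    | add a b ha hb => simp only [map_add, ha, hb]
    | tmul a b => simp
  have h2 : antipodeHom K (graft K (forest K m)) =
      - LinearMap.mul' K (HR K) ((graft K).lTensor (HR K) (antipodeAux K (forest K m))) := by
    rw [antipodeHom, AlgHom.comp_apply, AlgHom.comp_apply, antipodeAux_graft_forest, map_sub,
      map_id_counitHom_graft]
    simp
  rw [coproduct_graft, map_add, h1, ← ih, antipodeAux_graft_forest,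
    Algebra.TensorProduct.map_tmul, h2]
  simp only [map_one, TensorProduct.neg_tmul]
  abel

open WithConv in
theorem antipodeHom_mul_id : toConv (antipodeHom K) * toConv (AlgHom.id K (HR K)) = 1 := by
  apply WithConv.ext
  refine algHom_ext fun m ih => ?_
  rw [AlgHom.convMul_def, AlgHom.convOne_def]
  change Algebra.TensorProduct.lmul' K
    (((Algebra.TensorProduct.map (antipodeHom K) (.id K (HR K))).comp (coproduct K))
      (graft K (forest K m))) = algebraMap K (HR K) (counitHom K (graft K (forest K m)))
  rw [← antipodeAux_eq, antipodeAux_graft_forest, counitHom_graft, map_sub, map_zero]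
  simp only [Algebra.TensorProduct.lmul'_apply_tmul, mul_one]
  exact sub_self _

open WithConv in
/-- The Hopf algebra `H_R`. -/
instance instHopfAlgebra : HopfAlgebra K (HR K) :=
  HopfAlgebra.ofConvInverse (antipodeHom K).toLinearMap
    (congrArg (fun φ => toConv φ.ofConv.toLinearMap) (antipodeHom_mul_id K))
    (by
      have h1 := antipodeHom_mul_id K
      have h2 : toConv ((antipodeHom K).comp (antipodeHom K)) * toConv (antipodeHom K) = 1 := by
        have := AlgHom.comp_convMul_distrib (antipodeHom K) (toConv (antipodeHom K))
          (toConv (AlgHom.id K (HR K)))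
        rw [h1] at this
        apply WithConv.ext
        refine Eq.trans this.symm ?_
        ext x
        exact (antipodeHom K).commutes _
      have h3 : toConv (AlgHom.id K (HR K)) * toConv (antipodeHom K) = 1 := by
        rw [← left_inv_eq_right_inv h2 h1]
        exact h2
      exact congrArg (fun φ => toConv φ.ofConv.toLinearMap) h3)

end HR

/-! ### The toy model -/

namespace ToyModel

open HR

/-- The admissible integrands: continuous functions `f` on `[0, ∞)` such that
`f(ζ) = c / ζ + O(ζ ^ (-1 - ε))` for `ζ → ∞`, for some constant `c` and some `ε > 0`. -/
def IsAdmissible (f : ℝ → ℂ) : Prop :=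
  ContinuousOn f (Ici 0) ∧ ∃ c : ℂ, ∃ ε > (0 : ℝ),
    (fun ζ : ℝ => f ζ - c / (ζ : ℂ)) =O[atTop] fun ζ : ℝ => ζ ^ (-1 - ε)

/-- The integrand `f(ζ) = 1 / (ζ + 1)` of the original toy model is admissible. -/
theorem isAdmissible_one_div : IsAdmissible fun ζ : ℝ => 1 / ((ζ : ℂ) + 1) := by
  refine ⟨?_, 1, 1, one_pos, ?_⟩
  · refine ContinuousOn.div continuousOn_const (by fun_prop) fun ζ hζ => ?_
    have : (ζ : ℝ) + 1 ≠ 0 := by have : (0 : ℝ) ≤ ζ := hζ; positivity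
    exact_mod_cast this
  · refine Asymptotics.IsBigO.of_bound 1 ?_
    filter_upwards [eventually_gt_atTop (0 : ℝ)] with ζ hζ
    have h : 1 / ((ζ : ℂ) + 1) - 1 / (ζ : ℂ) = ((-(1 / (ζ * (ζ + 1))) : ℝ) : ℂ) := by
      have h1 : (ζ : ℂ) ≠ 0 := by exact_mod_cast hζ.ne'
      have h2 : (ζ : ℂ) + 1 ≠ 0 := by exact_mod_cast (by positivity : (ζ : ℝ) + 1 ≠ 0)
      push_cast
      field_simp
      ring
    rw [h, Complex.norm_real, norm_neg, Real.norm_of_nonneg (by positivity),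
      Real.norm_of_nonneg (by positivity), one_mul, show (-1 - 1 : ℝ) = ((-2 : ℤ) : ℝ) by norm_num,
      Real.rpow_intCast, zpow_neg, one_div]
    exact inv_anti₀ (by positivity) (by norm_cast; nlinarith)

/-- The target algebra of the regularized Feynman rules: functions of the regulator `z` and of the
external parameter `s`. Only the values at `s > 0` matter. -/
abbrev Target : Type := ℂ → ℝ → ℂ

/-- The integrand `ζ ↦ f(ζ) (sζ)^(-z) φ_{sζ}` of the toy model. -/
def integrand (f : ℝ → ℂ) (φ : Target) (z : ℂ) (s ζ : ℝ) : ℂ :=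
  f ζ * ((s * ζ : ℝ) : ℂ) ^ (-z) * φ z (s * ζ)

/-- The regularized Feynman rules `φ` of the toy model: the algebra morphism such that
`φ_s (B₊(x)) = ∫₀^∞ f(ζ) (sζ)^(-z) φ_{sζ}(x) dζ` for every forest `x`. -/
def feynman (f : ℝ → ℂ) : HR ℂ →ₐ[ℂ] Target :=
  lift (RTree.fold fun _ φ => fun z s => ∫ ζ in Ioi (0 : ℝ), integrand f φ z s ζ)

theorem feynman_graft_forest (f : ℝ → ℂ) (m : Multiset RTree) (z : ℂ) (s : ℝ) :
    feynman f (graft ℂ (forest ℂ m)) z s =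
      ∫ ζ in Ioi (0 : ℝ), integrand f (feynman f (forest ℂ m)) z s ζ := by
  rw [feynman, lift_graft_forest]

/-- The momentum scheme with subtraction point `ρ`: evaluation at `s = ρ`. -/
def momentumScheme (ρ : ℝ) : Target →ₐ[ℂ] Target where
  toFun φ := fun z _ => φ z ρ
  map_one' := rfl
  map_mul' _ _ := rfl
  map_zero' := rfl
  map_add' _ _ := rfl
  commutes' _ := rfl

/-- The counterterm `R_ρ ∘ φ ∘ S` in the momentum scheme. -/
def counterterm (f : ℝ → ℂ) (ρ : ℝ) : HR ℂ →ₐ[ℂ] Target :=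
  ((momentumScheme ρ).comp (feynman f)).comp (HopfAlgebra.antipodeAlgHom ℂ (HR ℂ))

/-- The renormalized Feynman rules: the convolution product of the counterterm and the regularized
Feynman rules. -/
def renormalized (f : ℝ → ℂ) (ρ : ℝ) : HR ℂ →ₐ[ℂ] Target :=
  (WithConv.toConv (counterterm f ρ) * WithConv.toConv (feynman f)).ofConv

/-- The renormalized Feynman rules and the counterterm form the Birkhoff decomposition of the
regularized ones: the former vanish under the momentum scheme on the kernel of the counit, the
latter has values in the range of the momentum scheme, and `φ₋ ⋆ φ = φ₊` by definition. -/
theorem momentumScheme_renormalized (f : ℝ → ℂ) (ρ : ℝ) (x : HR ℂ)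
    (hx : Coalgebra.counit (R := ℂ) x = 0) : momentumScheme ρ (renormalized f ρ x) = 0 := by
  have h := AlgHom.comp_convMul_distrib (momentumScheme ρ) (WithConv.toConv (counterterm f ρ))
    (WithConv.toConv (feynman f))
  have h' := AlgHom.comp_convMul_distrib ((momentumScheme ρ).comp (feynman f))
    (WithConv.toConv (HopfAlgebra.antipodeAlgHom ℂ (HR ℂ)))
    (WithConv.toConv (AlgHom.id ℂ (HR ℂ)))
  rw [AlgHom.antipode_id_cancel] at h'
  refine (AlgHom.congr_fun (h.trans h'.symm) x).trans ?_
  change momentumScheme ρ (feynman f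
    (algebraMap ℂ (HR ℂ) (Coalgebra.counit (R := ℂ) x))) = 0
  rw [hx, map_zero, map_zero, map_zero]

/-- Approach of the regulator to zero inside the half plane `Re z > 0`. -/
def regulatorLimit : Filter ℂ := 𝓝[{z : ℂ | 0 < z.re}] 0

end ToyModel

end

namespace ToyModel

/-! ### The Mellin transform of an admissible integrand -/

/-! Write `M(w) = ∫₀^∞ f(ζ) ζ^(-w) dζ`. The integral operator of the toy model is diagonal on powers
of the scale: it sends `s^(-kz)` to `M((k+1)z) s^(-(k+1)z)`. Splitting off the tail `c/ζ` shows that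
`w M(w)` is holomorphic at `0` (`IsAdmissible.exists_analyticAt`), so each grafting adds at most one
pole order in `z`. For small `Re z > 0` all integrals converge, which is the first claim.

For the second claim, the cocycle property of `B₊` and the independence of the counterterm from the
scale turn the renormalized rules into a subtracted recursion (`IsAdmissible.renormalized_graft`):
apply the integral operator and subtract its value at `ρ`. Hence on a forest they equal `ρ^(-dz) ∑
b_i(z) exp(-ℓ k_i z)` with `ℓ = ln (s/ρ)`, and a grafting replaces each pair `(b_i, k_i)` by `(b_i
M((k_i+1)z), k_i+1)` and `(-b_i M((k_i+1)z), 0)`.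

The invariant carried through this recursion is `IsRegularFamily`: although the `b_i` have poles,
every moment `∑ b_i (k_i z)^m` is holomorphic at `0`. Products preserve it by the binomial theorem.
Grafting preserves it (`IsRegularFamily.graft`) because the subtraction makes the zeroth moment
vanish, and in every higher moment a factor `w = (k_i+1)z` cancels the pole of `M(w)`. Expanding the
exponential into moments then gives holomorphy at `z = 0`; the bound on the pole orders truncates
the limit to a polynomial in `ℓ`. -/

theorem IsAdmissible.locallyIntegrableOn {f : ℝ → ℂ} (hf : IsAdmissible f) :
    LocallyIntegrableOn f (Ioi 0) :=
  (hf.1.mono Ioi_subset_Ici_self).locallyIntegrableOn measurableSet_Ioi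

theorem IsAdmissible.isBigO_zero {f : ℝ → ℂ} (hf : IsAdmissible f) :
    f =O[𝓝[>] 0] fun x : ℝ => x ^ (-(0 : ℝ)) := by
  have h : Tendsto f (𝓝[>] 0) (𝓝 (f 0)) :=
    (hf.1 0 self_mem_Ici).mono_left (nhdsWithin_mono _ Ioi_subset_Ici_self)
  simpa using h.isBigO_one ℝ

theorem IsAdmissible.isBigO_atTop {f : ℝ → ℂ} (hf : IsAdmissible f) :
    f =O[atTop] fun x : ℝ => x ^ (-(1 : ℝ)) := by
  obtain ⟨-, c, ε, hε, h⟩ := hf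
  have h1 : (fun x : ℝ => x ^ (-1 - ε)) =O[atTop] fun x : ℝ => x ^ (-(1 : ℝ)) := by
    refine Asymptotics.IsBigO.of_bound 1 ?_
    filter_upwards [eventually_ge_atTop (1 : ℝ)] with x hx
    rw [Real.norm_of_nonneg (by positivity), Real.norm_of_nonneg (by positivity), one_mul]
    exact Real.rpow_le_rpow_of_exponent_le hx (by linarith)
  have h2 : (fun x : ℝ => c / (x : ℂ)) =O[atTop] fun x : ℝ => x ^ (-(1 : ℝ)) := by
    refine Asymptotics.IsBigO.of_bound ‖c‖ ?_
    filter_upwards [eventually_gt_atTop (0 : ℝ)] with x hx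
    rw [norm_div, Complex.norm_real, Real.rpow_neg_one, norm_inv, div_eq_mul_inv]
  simpa using (h.trans h1).add h2

/-- The decay like `1/ζ` at infinity accounts for `Re z > 0`, boundedness near `0` for `Re z < 1`.
In Mellin's normalization `ζ^(s-1)` the argument is `s = 1 - z`. -/
theorem IsAdmissible.integrableOn {f : ℝ → ℂ} (hf : IsAdmissible f) {z : ℂ}
    (h0 : 0 < z.re) (h1 : z.re < 1) :
    IntegrableOn (fun ζ : ℝ => f ζ * (ζ : ℂ) ^ (-z)) (Ioi 0) := by
  have h := mellinConvergent_of_isBigO_rpow (s := 1 - z) hf.locallyIntegrableOn hf.isBigO_atTop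
    (by simpa using h0) hf.isBigO_zero (by simpa using h1)
  simpa [MellinConvergent, mul_comm] using h

/-- The integral `∫₀^∞ f(ζ) ζ^(-z) dζ`. -/
noncomputable def mellinIntegral (f : ℝ → ℂ) (z : ℂ) : ℂ := ∫ ζ in Ioi (0 : ℝ), f ζ * (ζ : ℂ) ^ (-z)

/-- The integral `∫₀^∞ f(ζ) ζ^(-z) dζ` has at most a simple pole at `z = 0`. -/
theorem IsAdmissible.exists_analyticAt {f : ℝ → ℂ} (hf : IsAdmissible f) :
    ∃ G : ℂ → ℂ, AnalyticAt ℂ G 0 ∧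
      ∀ z : ℂ, 0 < z.re → z.re < 1 → z * mellinIntegral f z = G z := by
  have hf' := hf
  obtain ⟨-, c, ε, hε, hO⟩ := hf
  -- The tail `p` carries the whole pole: its integral against `ζ^(-z)` is `c / z`, while `f - p` is
  -- `O(ζ^(-1-ε))` and so has a Mellin transform holomorphic for `-ε < Re z < 1`. The cut at `1`
  -- keeps `p` away from the singularity of `c / ζ` at `0`.
  set p : ℝ → ℂ := (Ioi (1 : ℝ)).indicator fun ζ : ℝ => c / (ζ : ℂ) with hp
  have hp_int : LocallyIntegrableOn p (Ioi 0) := by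
    have hc : ContinuousOn (fun ζ : ℝ => c / (ζ : ℂ)) (Ioi 0) := by
      refine continuousOn_const.div (by fun_prop) fun ζ hζ => ?_
      exact_mod_cast (ne_of_gt hζ)
    rw [locallyIntegrableOn_iff isOpen_Ioi.isLocallyClosed]
    intro k hk hk'
    exact ((hc.mono hk).integrableOn_compact hk').indicator measurableSet_Ioi
  have hd : ∀ᶠ z in 𝓝 (0 : ℂ), DifferentiableAt ℂ (fun z => mellin (f - p) (1 - z)) z := by
    have : ∀ᶠ z : ℂ in 𝓝 0, z.re ∈ Ioo (-ε) 1 :=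
      Complex.continuous_re.continuousAt.eventually_mem (Ioo_mem_nhds (by simpa) (by simp))
    filter_upwards [this] with z hz
    have h : DifferentiableAt ℂ (mellin (f - p)) (1 - z) := by
      refine mellin_differentiableAt_of_isBigO_rpow (a := 1 + ε) (b := 0)
        (hf'.locallyIntegrableOn.sub hp_int) ?_ ?_ ?_ ?_
      · refine (hO.congr' ?_ ?_)
        · filter_upwards [eventually_gt_atTop (1 : ℝ)] with x hx
          simp [hp, hx]
        · filter_upwards with x
          ring_nf
      · simp only [Complex.sub_re, Complex.one_re]
        linarith [hz.1]
      · refine hf'.isBigO_zero.congr' ?_ EventuallyEq.rfl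
        filter_upwards [Ioo_mem_nhdsGT (zero_lt_one (α := ℝ))] with x hx
        simp [hp, hx.2.le]
      · simpa using hz.2
    exact h.comp z (by fun_prop)
  have ha : AnalyticAt ℂ (fun z => mellin (f - p) (1 - z)) 0 :=
    Complex.analyticAt_iff_eventually_differentiableAt.2 hd
  refine ⟨fun z => z * mellin (f - p) (1 - z) + c, by fun_prop, fun z h0 h1 => ?_⟩
  have hz : z ≠ 0 := by rintro rfl; simp at h0
  have he : (fun ζ : ℝ => p ζ * (ζ : ℂ) ^ (-z)) =
      (Ioi (1 : ℝ)).indicator fun ζ : ℝ => c * (ζ : ℂ) ^ (-z - 1) := by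
    ext ζ
    by_cases hζ : ζ ∈ Ioi (1 : ℝ)
    · have : (ζ : ℂ) ≠ 0 := by exact_mod_cast (zero_lt_one.trans hζ).ne'
      rw [hp, indicator_of_mem hζ, indicator_of_mem hζ, Complex.cpow_sub _ _ this,
        Complex.cpow_one]
      ring
    · rw [hp, indicator_of_notMem hζ, indicator_of_notMem hζ, zero_mul]
  have hre : (-z - 1).re < -1 := by
    simp only [Complex.sub_re, Complex.neg_re, Complex.one_re]
    linarith
  have hsub : Ioi (1 : ℝ) ∩ Ioi 0 = Ioi 1 := inter_eq_left.2 (Ioi_subset_Ioi zero_le_one)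
  have hi : IntegrableOn (fun ζ : ℝ => p ζ * (ζ : ℂ) ^ (-z)) (Ioi 0) := by
    rw [he, IntegrableOn, integrable_indicator_iff measurableSet_Ioi, IntegrableOn,
      Measure.restrict_restrict measurableSet_Ioi, hsub]
    exact (integrableOn_Ioi_cpow_of_lt hre zero_lt_one).const_mul c
  have hv : ∫ ζ in Ioi (0 : ℝ), p ζ * (ζ : ℂ) ^ (-z) = c / z := by
    rw [he, integral_indicator measurableSet_Ioi, Measure.restrict_restrict measurableSet_Ioi,
      hsub, integral_const_mul, integral_Ioi_cpow_of_lt hre zero_lt_one]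
    simp [div_eq_mul_inv]
  have hm : mellin (f - p) (1 - z) = mellinIntegral f z - c / z := by
    rw [mellinIntegral, ← hv, ← integral_sub (hf'.integrableOn h0 h1) hi, mellin]
    refine setIntegral_congr_fun measurableSet_Ioi fun ζ _ => ?_
    simp only [Pi.sub_apply, smul_eq_mul, sub_sub_cancel_left]
    ring
  simp only [hm]
  field_simp
  ring

/-! ### Functions with a holomorphic extension to the origin -/

theorem regulatorLimit_le : regulatorLimit ≤ 𝓝 0 := nhdsWithin_le_nhds

theorem eventually_re_pos : ∀ᶠ z in regulatorLimit, 0 < z.re := self_mem_nhdsWithin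

/-- This is the strip in which the Mellin integral at `(n + 1) z` converges. How small `z` must be
depends on `n`, hence on the forest. -/
theorem eventually_mul_re (n : ℕ) :
    ∀ᶠ z : ℂ in regulatorLimit, 0 < (z * (n + 1)).re ∧ (z * (n + 1)).re < 1 := by
  have h : ∀ᶠ z : ℂ in 𝓝 0, (z * (n + 1)).re < 1 :=
    (by fun_prop : Continuous fun z : ℂ => (z * (n + 1)).re).continuousAt.eventually_lt
      continuousAt_const (by simp)
  filter_upwards [regulatorLimit_le h, eventually_re_pos] with z h1 h0
  refine ⟨?_, h1⟩
  have : (z * (n + 1)).re = z.re * (n + 1) := by simp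
  rw [this]
  positivity

/-- Functions of the regulator that extend from small `z` with `Re z > 0` to a function that is
holomorphic at `z = 0`. -/
def ExtendsAnalytically (u : ℂ → ℂ) : Prop :=
  ∃ g : ℂ → ℂ, AnalyticAt ℂ g 0 ∧ ∀ᶠ z in regulatorLimit, u z = g z

namespace ExtendsAnalytically

variable {u v : ℂ → ℂ}

theorem of_analyticAt (h : AnalyticAt ℂ u 0) : ExtendsAnalytically u :=
  ⟨u, h, Eventually.of_forall fun _ => rfl⟩

theorem congr (hu : ExtendsAnalytically u) (h : ∀ᶠ z in regulatorLimit, v z = u z) :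
    ExtendsAnalytically v := by
  obtain ⟨g, hg, hug⟩ := hu
  exact ⟨g, hg, by filter_upwards [h, hug] with z h1 h2 using h1.trans h2⟩

theorem add (hu : ExtendsAnalytically u) (hv : ExtendsAnalytically v) :
    ExtendsAnalytically fun z => u z + v z := by
  obtain ⟨g, hg, hug⟩ := hu
  obtain ⟨k, hk, hvk⟩ := hv
  exact ⟨fun z => g z + k z, by fun_prop,
    by filter_upwards [hug, hvk] with z h1 h2 using by rw [h1, h2]⟩

theorem mul (hu : ExtendsAnalytically u) (hv : ExtendsAnalytically v) :
    ExtendsAnalytically fun z => u z * v z := by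
  obtain ⟨g, hg, hug⟩ := hu
  obtain ⟨k, hk, hvk⟩ := hv
  exact ⟨fun z => g z * k z, by fun_prop,
    by filter_upwards [hug, hvk] with z h1 h2 using by rw [h1, h2]⟩

theorem sum {ι : Type*} (s : Finset ι) {u : ι → ℂ → ℂ}
    (hu : ∀ i ∈ s, ExtendsAnalytically (u i)) :
    ExtendsAnalytically fun z => ∑ i ∈ s, u i z := by
  classical
  induction s using Finset.induction_on with
  | empty => simpa using of_analyticAt analyticAt_const
  | insert a s ha ih =>
    simp only [Finset.sum_insert ha]
    exact (hu a (Finset.mem_insert_self a s)).add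
      (ih fun i hi => hu i (Finset.mem_insert_of_mem hi))

theorem tendsto (hu : ExtendsAnalytically u) : ∃ a, Tendsto u regulatorLimit (𝓝 a) := by
  obtain ⟨g, hg, hug⟩ := hu
  exact ⟨g 0, (hg.continuousAt.tendsto.mono_left regulatorLimit_le).congr'
    (hug.mono fun _ h => h.symm)⟩

end ExtendsAnalytically

theorem analyticAt_comp_mul {H : ℂ → ℂ} (hH : AnalyticAt ℂ H 0) (a : ℂ) :
    AnalyticAt ℂ (fun z => H (z * a)) 0 :=
  AnalyticAt.fun_comp (g := H) (f := fun z => z * a) (by simpa using hH) (by fun_prop)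

/-! ### Regular families of meromorphic functions -/

/-- A finite family of functions `b i` with poles of bounded order at `z = 0`, and of exponents
`k i`, such that the poles cancel in all moments `∑ i, b i * (k i * z) ^ m`. Then they cancel in
`∑ i, b i * H (k i * z)` for all `H` that are holomorphic at `0`. -/
structure IsRegularFamily {ι : Type} [Fintype ι] (b : ι → ℂ → ℂ) (k : ι → ℕ) : Prop where
  exists_order : ∃ N : ℕ, ∀ i, ExtendsAnalytically fun z => z ^ N * b i z
  moment : ∀ m : ℕ, ExtendsAnalytically fun z => ∑ i, b i z * (z * k i) ^ m

namespace IsRegularFamily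

variable {ι κ : Type} [Fintype ι] [Fintype κ] {b : ι → ℂ → ℂ} {k : ι → ℕ}
  {b' : κ → ℂ → ℂ} {k' : κ → ℕ}

theorem one : IsRegularFamily (fun _ _ => 1 : Unit → ℂ → ℂ) (fun _ => 0) where
  exists_order := ⟨0, fun _ => .of_analyticAt (by fun_prop)⟩
  moment _ := .of_analyticAt (by fun_prop)

/-- By the binomial theorem a moment of the product family is a finite combination of products of
moments of the factors; the pole orders add. -/
theorem mul (h : IsRegularFamily b k) (h' : IsRegularFamily b' k') :
    IsRegularFamily (fun i : ι × κ => fun z => b i.1 z * b' i.2 z)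
      (fun i => k i.1 + k' i.2) where
  exists_order := by
    obtain ⟨N, hN⟩ := h.exists_order
    obtain ⟨N', hN'⟩ := h'.exists_order
    refine ⟨N + N', fun i => ((hN i.1).mul (hN' i.2)).congr (Eventually.of_forall fun z => ?_)⟩
    ring
  moment m := by
    have key : ExtendsAnalytically fun z => ∑ j ∈ Finset.range (m + 1),
        (∑ i, b i z * (z * k i) ^ j) * (∑ i, b' i z * (z * k' i) ^ (m - j)) * (m.choose j : ℂ) :=
      .sum _ fun j _ => ((h.moment j).mul (h'.moment _)).mul (.of_analyticAt analyticAt_const)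
    refine key.congr (Eventually.of_forall fun z => ?_)
    simp only [Finset.sum_mul]
    rw [Finset.sum_comm, Fintype.sum_prod_type]
    refine Finset.sum_congr rfl fun i _ => ?_
    simp only [Finset.mul_sum, Finset.sum_mul]
    rw [Finset.sum_comm]
    refine Finset.sum_congr rfl fun i' _ => ?_
    rw [Nat.cast_add, mul_add, add_pow, Finset.mul_sum]
    refine Finset.sum_congr rfl fun j _ => ?_
    ring

/-- The exponents `k i + 1` are those produced by one application of the integral operator; the
binomial theorem reduces to the moments with `k i`. -/
theorem moment_succ (h : IsRegularFamily b k) (m : ℕ) :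
    ExtendsAnalytically fun z => ∑ i, b i z * (z * (k i + 1)) ^ m := by
  have key : ExtendsAnalytically fun z => ∑ j ∈ Finset.range (m + 1),
      (∑ i, b i z * (z * k i) ^ j) * (z ^ (m - j) * (m.choose j : ℂ)) :=
    .sum _ fun j _ => (h.moment j).mul (.of_analyticAt (by fun_prop))
  refine key.congr (Eventually.of_forall fun z => ?_)
  simp only [Finset.sum_mul]
  rw [Finset.sum_comm]
  refine Finset.sum_congr rfl fun i _ => ?_
  rw [mul_add, mul_one, add_pow, Finset.mul_sum]
  refine Finset.sum_congr rfl fun j _ => ?_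
  ring

/-- Taylor expansion of `H` to the order `N` of the poles: the Taylor polynomial contributes
moments, and the factor `z ^ N` in the remainder cancels the poles of each `b i` separately. -/
theorem comp_succ (h : IsRegularFamily b k) {H : ℂ → ℂ} (hH : AnalyticAt ℂ H 0) :
    ExtendsAnalytically fun z => ∑ i, b i z * H (z * (k i + 1)) := by
  obtain ⟨N, hN⟩ := h.exists_order
  obtain ⟨F, hF, hHF⟩ := hH.exists_eq_sum_add_pow_mul N
  have key : ExtendsAnalytically fun z =>
      (∑ j ∈ Finset.range N, (∑ i, b i z * (z * (k i + 1)) ^ j) *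
        (iteratedDeriv j H 0 / j.factorial)) +
      ∑ i, z ^ N * b i z * ((k i + 1 : ℂ) ^ N * F (z * (k i + 1))) :=
    (ExtendsAnalytically.sum _ fun j _ => (h.moment_succ j).mul (.of_analyticAt
      analyticAt_const)).add (.sum _ fun i _ => (hN i).mul (.of_analyticAt
        (analyticAt_const.mul (analyticAt_comp_mul hF _))))
  refine key.congr (Eventually.of_forall fun z => ?_)
  simp only [Finset.sum_mul]
  rw [Finset.sum_comm, ← Finset.sum_add_distrib]
  refine Finset.sum_congr rfl fun i _ => ?_
  rw [hHF, mul_add, Finset.mul_sum, smul_eq_mul, mul_pow]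
  congr 1
  · refine Finset.sum_congr rfl fun j _ => ?_
    rw [smul_eq_mul]
    ring
  · ring

/-- The family that arises from the Mellin transform of an admissible integrand by subtraction
at the reference scale. -/
theorem graft {f : ℝ → ℂ} (hf : IsAdmissible f) (h : IsRegularFamily b k) :
    IsRegularFamily
      (Sum.elim (fun i z => b i z * mellinIntegral f (z * (k i + 1)))
        (fun i z => -(b i z * mellinIntegral f (z * (k i + 1)))))
      (Sum.elim (fun i => k i + 1) (fun _ => 0)) := by
  obtain ⟨G, hG, hGf⟩ := hf.exists_analyticAt
  have hG' : ∀ᶠ z in regulatorLimit, ∀ i,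
      z * (k i + 1) * mellinIntegral f (z * (k i + 1)) = G (z * (k i + 1)) :=
    eventually_all.2 fun i => (eventually_mul_re (k i)).mono fun z hz => hGf _ hz.1 hz.2
  have hk : ∀ i, (k i + 1 : ℂ) ≠ 0 := fun i => Nat.cast_add_one_ne_zero _
  constructor
  · obtain ⟨N, hN⟩ := h.exists_order
    -- The Mellin integral has at most a simple pole, so one additional power of `z` suffices.
    have key : ∀ i, ExtendsAnalytically fun z =>
        z ^ (N + 1) * (b i z * mellinIntegral f (z * (k i + 1))) := fun i => by
      refine ((hN i).mul (.of_analyticAt ((analyticAt_comp_mul hG (k i + 1)).div_const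
        (c := (k i + 1 : ℂ))))).congr (hG'.mono fun z hz => ?_)
      have := hk i
      rw [← hz i]
      field_simp
      ring
    refine ⟨N + 1, Sum.rec key fun i => ?_⟩
    refine ((key i).mul (.of_analyticAt (analyticAt_const (v := -1)))).congr
      (Eventually.of_forall fun z => ?_)
    simp only [Sum.elim_inr]
    ring
  · rintro (_ | m)
    -- The zeroth moment vanishes identically: the two halves of the family cancel. This is the
    -- effect of the subtraction at the reference scale.
    · refine (ExtendsAnalytically.of_analyticAt (analyticAt_const (v := 0))).congr
        (Eventually.of_forall fun z => ?_)
      simp [Fintype.sum_sum_type]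
    -- In higher moments the subtracted terms drop out, having exponent `0`, and one factor `w`
    -- turns the Mellin integral at `w = z (k i + 1)` into the holomorphic `G w`.
    · have hH : AnalyticAt ℂ (fun w => G w * w ^ m) 0 := by fun_prop
      refine (h.comp_succ hH).congr (hG'.mono fun z hz => ?_)
      simp only [Fintype.sum_sum_type, Sum.elim_inl, Sum.elim_inr, Nat.cast_zero, mul_zero,
        pow_succ, Finset.sum_const_zero, add_zero, Nat.cast_add, Nat.cast_one]
      refine Finset.sum_congr rfl fun i _ => ?_
      rw [← hz i]
      ring

/-- The sums `∑ i, b i * exp (-ℓ * k i * z)` of a regular family are holomorphic at `z = 0`. -/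
theorem extendsAnalytically_exp (h : IsRegularFamily b k) (l : ℂ) :
    ExtendsAnalytically fun z => ∑ i, b i z * Complex.exp (-l * (z * k i)) := by
  have hH : AnalyticAt ℂ (fun w => Complex.exp (-l * w)) 0 := by fun_prop
  -- The factor `exp (l z)` undoes the shift from `k i` to `k i + 1` in `comp_succ`.
  refine ((h.comp_succ hH).mul (.of_analyticAt (u := fun z => Complex.exp (l * z))
    (by fun_prop))).congr (Eventually.of_forall fun z => ?_)
  rw [Finset.sum_mul]
  refine Finset.sum_congr rfl fun i _ => ?_
  rw [mul_assoc, ← Complex.exp_add]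
  ring_nf

/-- The values at `z = 0` of the sums `∑ i, b i * exp (-ℓ * k i * z)` of a regular family are
polynomial in `ℓ`. -/
theorem exists_polynomial (h : IsRegularFamily b k) :
    ∃ P : Polynomial ℂ, ∀ l : ℂ,
      Tendsto (fun z => ∑ i, b i z * Complex.exp (-l * (z * k i))) regulatorLimit
        (𝓝 (P.eval l)) := by
  obtain ⟨N, hN⟩ := h.exists_order
  -- One order beyond the poles: after `z ^ N` has cancelled them, a factor `z` is left that makes
  -- the remainder vanish in the limit.
  obtain ⟨F, hF, hexp⟩ := (by fun_prop : AnalyticAt ℂ Complex.exp 0).exists_eq_sum_add_pow_mul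
    (N + 1)
  choose M hM using fun m => (h.moment m).tendsto
  set c : ℕ → ℂ := fun j => iteratedDeriv j Complex.exp 0 / j.factorial
  -- The coefficients are the limits `M j` of the moments times the Taylor coefficients of `exp`;
  -- neither depends on `l`.
  refine ⟨∑ j ∈ Finset.range (N + 1), Polynomial.C (M j * c j) * (-Polynomial.X) ^ j,
    fun l => ?_⟩
  have h1 : Tendsto (fun z => ∑ j ∈ Finset.range (N + 1),
      (∑ i, b i z * (z * k i) ^ j) * (c j * (-l) ^ j)) regulatorLimit
      (𝓝 (∑ j ∈ Finset.range (N + 1), M j * (c j * (-l) ^ j))) :=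
    tendsto_finsetSum _ fun j _ => (hM j).mul_const _
  have h2 : Tendsto (fun z => ∑ i, z ^ N * b i z *
      (z * ((-l * k i) ^ (N + 1) * F (z * (-l * k i))))) regulatorLimit
      (𝓝 (∑ _i : ι, 0)) := by
    refine tendsto_finsetSum _ fun i _ => ?_
    obtain ⟨a, ha⟩ := (hN i).tendsto
    have hz : Tendsto (fun z : ℂ => z) regulatorLimit (𝓝 0) := regulatorLimit_le
    have hFc := (analyticAt_comp_mul hF (-l * k i)).continuousAt.tendsto.mono_left
      regulatorLimit_le
    simpa using ha.mul (hz.mul (hFc.const_mul ((-l * k i) ^ (N + 1))))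
  convert (h1.add h2).congr fun z => ?_ using 2
  · simp [Polynomial.eval_finsetSum, mul_assoc]
  · simp only [Finset.sum_mul]
    rw [Finset.sum_comm, ← Finset.sum_add_distrib]
    refine Finset.sum_congr rfl fun i _ => ?_
    rw [hexp, mul_add, Finset.mul_sum]
    congr 1
    · refine Finset.sum_congr rfl fun j _ => ?_
      simp only [smul_eq_mul, c]
      ring
    · rw [show -l * (z * k i) = z * (-l * k i) by ring, smul_eq_mul]
      ring

end IsRegularFamily

end ToyModel

/-! ### Induction principles for forests -/

/-- A property of the elements of `H_R` that is linear holds as soon as it holds for forests. -/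
theorem HR.forest_induction {K : Type*} [CommRing K] {P : HR K → Prop}
    (forest : ∀ m, P (HR.forest K m)) (add : ∀ x y, P x → P y → P (x + y))
    (smul : ∀ (c : K) x, P x → P (c • x)) (x : HR K) : P x := by
  have hx : x ∈ Submodule.span K (range (HR.forestBasis K)) := (HR.forestBasis K).mem_span x
  induction hx using Submodule.span_induction with
  | mem x h =>
    obtain ⟨d, rfl⟩ := h
    rw [HR.forestBasis_apply]
    exact forest _
  | zero => simpa using smul 0 _ (forest 0)
  | add x y _ _ hx hy => exact add x y hx hy
  | smul c x _ hx => exact smul c x hx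

/-- A property of forests holds for all of them if it holds for the empty forest, is compatible
with disjoint unions, and passes from a forest `x` to the tree `B₊(x)`. -/
theorem HR.forest_rec {P : Multiset RTree → Prop} (zero : P 0)
    (add : ∀ m m', P m → P m' → P (m + m')) (node : ∀ m, P m → P {RTree.node m})
    (m : Multiset RTree) : P m := by
  have key : ∀ m : Multiset RTree, (∀ t ∈ m, P {t}) → P m := fun m => by
    induction m using Multiset.induction_on with
    | empty => exact fun _ => zero
    | cons t m ih =>
      intro h
      rw [← Multiset.singleton_add]
      exact add _ _ (h t (Multiset.mem_cons_self t m))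
        (ih fun u hu => h u (Multiset.mem_cons_of_mem hu))
  have tree : ∀ t, P {t} := fun t => by
    induction t using RTree.induction with
    | h m ih => exact node m (key m ih)
  exact key m fun t _ => tree t

theorem HR.forest_add (K : Type*) [CommRing K] (m m' : Multiset RTree) :
    HR.forest K (m + m') = HR.forest K m * HR.forest K m' := by
  simp [HR.forest]

theorem HR.forest_singleton_node (K : Type*) [CommRing K] (m : Multiset RTree) :
    HR.forest K {RTree.node m} = HR.graft K (HR.forest K m) := by
  rw [HR.graft_forest]
  simp [HR.forest]

namespace ToyModel

open HR

theorem ofReal_mul_cpow {s ζ : ℝ} (hs : 0 < s) (hζ : 0 < ζ) (w : ℂ) :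
    ((s * ζ : ℝ) : ℂ) ^ w = (s : ℂ) ^ w * (ζ : ℂ) ^ w := by
  rw [Complex.ofReal_mul, Complex.mul_cpow_ofReal_nonneg hs.le hζ.le]

/-! ### The integral operator of the toy model -/

/-- `ψ` is the image of `φ` under the integral operator of the toy model, with absolutely
convergent integrals, at the regulator `z`. -/
def IntegratesTo (f : ℝ → ℂ) (φ ψ : Target) (z : ℂ) : Prop :=
  ∀ s : ℝ, 0 < s → IntegrableOn (integrand f φ z s) (Ioi 0) ∧
    ψ z s = ∫ ζ in Ioi (0 : ℝ), integrand f φ z s ζ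

namespace IntegratesTo

variable {f : ℝ → ℂ} {φ ψ φ' ψ' : Target} {z : ℂ}

theorem add (h : IntegratesTo f φ ψ z) (h' : IntegratesTo f φ' ψ' z) :
    IntegratesTo f (φ + φ') (ψ + ψ') z := fun s hs => by
  have he : integrand f (φ + φ') z s =
      fun ζ => integrand f φ z s ζ + integrand f φ' z s ζ := by
    ext ζ
    simp only [integrand, Pi.add_apply]
    ring
  rw [he, integral_add (h s hs).1 (h' s hs).1, ← (h s hs).2, ← (h' s hs).2]
  exact ⟨(h s hs).1.add (h' s hs).1, rfl⟩

theorem mul_left (h : IntegratesTo f φ ψ z) {χ : Target} {c : ℂ} (hχ : ∀ s, χ z s = c) :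
    IntegratesTo f (χ * φ) (χ * ψ) z := fun s hs => by
  have he : integrand f (χ * φ) z s = fun ζ => c * integrand f φ z s ζ := by
    ext ζ
    simp only [integrand, Pi.mul_apply, hχ]
    ring
  rw [he, integral_const_mul, ← (h s hs).2, ← hχ s]
  exact ⟨(h s hs).1.const_mul _, rfl⟩

theorem smul (h : IntegratesTo f φ ψ z) (c : ℂ) : IntegratesTo f (c • φ) (c • ψ) z := by
  have := h.mul_left (χ := fun _ _ => c) (c := c) fun _ => rfl
  convert this using 1 <;> ext <;> simp

theorem zero : IntegratesTo f 0 0 z := fun s _ => by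
  have he : integrand f 0 z s = fun _ => 0 := by
    ext ζ
    simp [integrand]
  rw [he]
  exact ⟨integrableOn_zero, by simp⟩

end IntegratesTo

/-- The integral operator of the toy model acts diagonally on powers of the scale. -/
theorem IsAdmissible.integral_integrand {f : ℝ → ℂ} (hf : IsAdmissible f) {φ : Target} {z : ℂ}
    {ι : Type*} [Fintype ι] {c : ι → ℂ} {k : ι → ℕ}
    (hk : ∀ i, 0 < (z * (k i + 1)).re ∧ (z * (k i + 1)).re < 1)
    (hφ : ∀ s : ℝ, 0 < s → φ z s = ∑ i, c i * (s : ℂ) ^ (-(z * k i))) {s : ℝ} (hs : 0 < s) :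
    IntegrableOn (integrand f φ z s) (Ioi 0) ∧
      ∫ ζ in Ioi (0 : ℝ), integrand f φ z s ζ =
        ∑ i, c i * (s : ℂ) ^ (-(z * (k i + 1))) * mellinIntegral f (z * (k i + 1)) := by
  have he : EqOn (fun ζ : ℝ => ∑ i, c i * (s : ℂ) ^ (-(z * (k i + 1))) *
      (f ζ * (ζ : ℂ) ^ (-(z * (k i + 1))))) (integrand f φ z s) (Ioi 0) := fun ζ hζ => by
    have hζ' : 0 < ζ := hζ
    have hsζ : ((s * ζ : ℝ) : ℂ) ≠ 0 := by exact_mod_cast (mul_pos hs hζ').ne'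
    simp only [integrand]
    rw [hφ _ (mul_pos hs hζ'), Finset.mul_sum]
    refine Finset.sum_congr rfl fun i _ => ?_
    have h1 : ((s * ζ : ℝ) : ℂ) ^ (-z) * ((s * ζ : ℝ) : ℂ) ^ (-(z * k i)) =
        (s : ℂ) ^ (-(z * (k i + 1))) * (ζ : ℂ) ^ (-(z * (k i + 1))) := by
      rw [← Complex.cpow_add _ _ hsζ, ← ofReal_mul_cpow hs hζ']
      congr 1
      ring
    linear_combination (-(f ζ * c i)) * h1
  have hi : ∀ i, IntegrableOn (fun ζ : ℝ => c i * (s : ℂ) ^ (-(z * (k i + 1))) *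
      (f ζ * (ζ : ℂ) ^ (-(z * (k i + 1))))) (Ioi 0) := fun i =>
    (hf.integrableOn (hk i).1 (hk i).2).const_mul _
  refine ⟨IntegrableOn.congr_fun (integrable_finsetSum _ fun i _ => hi i) he measurableSet_Ioi, ?_⟩
  rw [← setIntegral_congr_fun measurableSet_Ioi he, integral_finsetSum _ fun i _ => hi i]
  exact Finset.sum_congr rfl fun i _ => integral_const_mul _ _

/-! ### The regularized Feynman rules -/

/-- The regularized Feynman rules of a forest with `d` nodes are proportional to `s ^ (-d z)`. -/
theorem IsAdmissible.exists_feynman_forest {f : ℝ → ℂ} (hf : IsAdmissible f)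
    (m : Multiset RTree) : ∃ (d : ℕ) (a : ℂ → ℂ), ∀ᶠ z in regulatorLimit, ∀ s : ℝ, 0 < s →
      feynman f (forest ℂ m) z s = a z * (s : ℂ) ^ (-(z * d)) := by
  induction m using HR.forest_rec with
  | zero => exact ⟨0, fun _ => 1, Eventually.of_forall fun z s _ => by simp [forest]⟩
  | add m m' h h' =>
    obtain ⟨d, a, h⟩ := h
    obtain ⟨d', a', h'⟩ := h'
    refine ⟨d + d', fun z => a z * a' z, ?_⟩
    filter_upwards [h, h'] with z h h' s hs
    have hs' : (s : ℂ) ≠ 0 := by exact_mod_cast hs.ne'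
    rw [forest_add, map_mul, Pi.mul_apply, Pi.mul_apply, h s hs, h' s hs, Nat.cast_add, mul_add,
      neg_add, Complex.cpow_add _ _ hs']
    ring
  | node m h =>
    obtain ⟨d, a, h⟩ := h
    refine ⟨d + 1, fun z => a z * mellinIntegral f (z * (d + 1)), ?_⟩
    filter_upwards [h, eventually_mul_re d] with z h hd s hs
    rw [forest_singleton_node, feynman_graft_forest, (hf.integral_integrand (ι := Unit)
      (c := fun _ => a z) (k := fun _ => d) (fun _ => hd) (by simpa using h) hs).2]
    simp
    ring

/-- The defining recursion concerns forests only. Its extension to linear combinations needs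
additivity of the integral, so integrability is carried along; this also yields the absolute
convergence. -/
theorem IsAdmissible.feynman_graft {f : ℝ → ℂ} (hf : IsAdmissible f) (x : HR ℂ) :
    ∀ᶠ z in regulatorLimit, IntegratesTo f (feynman f x) (feynman f (graft ℂ x)) z := by
  induction x using HR.forest_induction with
  | forest m =>
    obtain ⟨d, a, h⟩ := hf.exists_feynman_forest m
    filter_upwards [h, eventually_mul_re d] with z h hd s hs
    exact ⟨(hf.integral_integrand (ι := Unit) (c := fun _ => a z) (k := fun _ => d) (fun _ => hd)
      (by simpa using h) hs).1, feynman_graft_forest f m z s⟩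
  | add x y hx hy =>
    filter_upwards [hx, hy] with z hx hy
    simpa only [map_add] using hx.add hy
  | smul c x hx =>
    filter_upwards [hx] with z hx
    simpa only [map_smul] using hx.smul c

/-! ### The renormalized Feynman rules -/

/-- The product of the counterterm and the regularized Feynman rules on `H_R ⊗ H_R`. -/
noncomputable def countertermMulFeynman (f : ℝ → ℂ) (ρ : ℝ) : HR ℂ ⊗[ℂ] HR ℂ →ₐ[ℂ] Target :=
  (Algebra.TensorProduct.lmul' ℂ).comp (Algebra.TensorProduct.map (counterterm f ρ) (feynman f))

theorem countertermMulFeynman_tmul (f : ℝ → ℂ) (ρ : ℝ) (x y : HR ℂ) :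
    countertermMulFeynman f ρ (x ⊗ₜ y) = counterterm f ρ x * feynman f y := rfl

theorem renormalized_apply (f : ℝ → ℂ) (ρ : ℝ) (x : HR ℂ) :
    renormalized f ρ x = countertermMulFeynman f ρ (Coalgebra.comul x) := rfl

theorem counterterm_apply_eq (f : ℝ → ℂ) (ρ : ℝ) (x : HR ℂ) (z : ℂ) (s s' : ℝ) :
    counterterm f ρ x z s = counterterm f ρ x z s' := rfl

/-- The counterterm on the left tensor factor does not depend on the scale and can be pulled out of
the integral. Thus `id ⊗ B₊` becomes the integral operator. -/
theorem IsAdmissible.countertermMulFeynman_graft {f : ℝ → ℂ} (hf : IsAdmissible f) (ρ : ℝ)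
    (y : HR ℂ ⊗[ℂ] HR ℂ) : ∀ᶠ z in regulatorLimit,
      IntegratesTo f (countertermMulFeynman f ρ y)
        (countertermMulFeynman f ρ ((graft ℂ).lTensor (HR ℂ) y)) z := by
  induction y with
  | zero => exact Eventually.of_forall fun z => by simpa only [map_zero] using IntegratesTo.zero
  | add x y hx hy =>
    filter_upwards [hx, hy] with z hx hy
    simpa only [map_add] using hx.add hy
  | tmul a b =>
    filter_upwards [hf.feynman_graft b] with z h
    rw [LinearMap.lTensor_tmul, countertermMulFeynman_tmul, countertermMulFeynman_tmul]
    exact h.mul_left fun s => counterterm_apply_eq f ρ a z s 0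

/-- The renormalized Feynman rules satisfy the subtracted integral equation. -/
theorem IsAdmissible.renormalized_graft {f : ℝ → ℂ} (hf : IsAdmissible f) {ρ : ℝ} (hρ : 0 < ρ)
    (x : HR ℂ) : ∀ᶠ z in regulatorLimit, ∀ s : ℝ, 0 < s →
      renormalized f ρ (graft ℂ x) z s =
        (∫ ζ in Ioi (0 : ℝ), integrand f (renormalized f ρ x) z s ζ) -
          ∫ ζ in Ioi (0 : ℝ), integrand f (renormalized f ρ x) z ρ ζ := by
  filter_upwards [hf.countertermMulFeynman_graft ρ (Coalgebra.comul x)] with z h s hs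
  have h0 : renormalized f ρ (graft ℂ x) z ρ = 0 :=
    congrFun (congrFun (momentumScheme_renormalized f ρ _ (counitHom_graft ℂ x)) z) ρ
  -- By the cocycle property the term `B₊(x) ⊗ 1` only adds a constant in the scale (read off at the
  -- arbitrary scale `0`). Vanishing at `s = ρ` determines this constant.
  have h1 : ∀ s, renormalized f ρ (graft ℂ x) z s = counterterm f ρ (graft ℂ x) z 0 +
      countertermMulFeynman f ρ ((graft ℂ).lTensor (HR ℂ) (Coalgebra.comul x)) z s := fun s => by
    rw [renormalized_apply, comul_graft, map_add, countertermMulFeynman_tmul, map_one, mul_one,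
      Pi.add_apply, Pi.add_apply, counterterm_apply_eq f ρ _ z s 0]
  rw [renormalized_apply f ρ x, ← (h s hs).2, ← (h ρ hρ).2]
  rw [h1] at h0 ⊢
  linear_combination h0

theorem exp_log_div {s ρ : ℝ} (hs : 0 < s) (hρ : 0 < ρ) (w : ℂ) :
    Complex.exp (-(Real.log (s / ρ) : ℝ) * w) = (s : ℂ) ^ (-w) * (ρ : ℂ) ^ w := by
  have hs' : (s : ℂ) ≠ 0 := by exact_mod_cast hs.ne'
  have hρ' : (ρ : ℂ) ≠ 0 := by exact_mod_cast hρ.ne'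
  rw [Complex.cpow_def_of_ne_zero hs', Complex.cpow_def_of_ne_zero hρ', ← Complex.exp_add,
    Real.log_div hs.ne' hρ.ne', ← Complex.ofReal_log hs.le, ← Complex.ofReal_log hρ.le,
    Complex.ofReal_sub]
  congr 1
  ring

/-- The renormalized Feynman rules of a forest with `d` nodes are `ρ ^ (-d z)` times the sum
`∑ i, b i * (s / ρ) ^ (-k i * z)` that belongs to a regular family. -/
theorem IsAdmissible.exists_regularFamily {f : ℝ → ℂ} (hf : IsAdmissible f)
    (m : Multiset RTree) :
    ∃ (ι : Type) (_ : Fintype ι) (b : ι → ℂ → ℂ) (k : ι → ℕ) (d : ℕ), IsRegularFamily b k ∧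
      ∀ ρ : ℝ, 0 < ρ → ∀ᶠ z in regulatorLimit, ∀ s : ℝ, 0 < s →
        renormalized f ρ (forest ℂ m) z s = (ρ : ℂ) ^ (-(z * d)) *
          ∑ i, b i z * Complex.exp (-(Real.log (s / ρ) : ℝ) * (z * k i)) := by
  induction m using HR.forest_rec with
  | zero =>
    exact ⟨Unit, inferInstance, _, _, 0, IsRegularFamily.one,
      fun ρ _ => Eventually.of_forall fun z s _ => by simp [forest]⟩
  | add m m' h h' =>
    obtain ⟨ι, _, b, k, d, hb, h⟩ := h
    obtain ⟨ι', _, b', k', d', hb', h'⟩ := h'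
    refine ⟨ι × ι', inferInstance, _, _, d + d', hb.mul hb', fun ρ hρ => ?_⟩
    filter_upwards [h ρ hρ, h' ρ hρ] with z h h' s hs
    have hρ' : (ρ : ℂ) ≠ 0 := by exact_mod_cast hρ.ne'
    rw [forest_add, map_mul, Pi.mul_apply, Pi.mul_apply, h s hs, h' s hs, mul_mul_mul_comm,
      Fintype.sum_mul_sum, Fintype.sum_prod_type, ← Complex.cpow_add _ _ hρ']
    congr 1
    · congr 1
      push_cast
      ring
    · refine Finset.sum_congr rfl fun i _ => Finset.sum_congr rfl fun j _ => ?_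
      rw [Nat.cast_add, mul_add z, mul_add (-_), Complex.exp_add]
      ring
  | node m h =>
    obtain ⟨ι, _, b, k, d, hb, h⟩ := h
    refine ⟨ι ⊕ ι, inferInstance, _, _, d + 1, hb.graft hf, fun ρ hρ => ?_⟩
    have hρ' : (ρ : ℂ) ≠ 0 := by exact_mod_cast hρ.ne'
    filter_upwards [h ρ hρ, hf.renormalized_graft hρ (forest ℂ m),
      eventually_all.2 fun i => eventually_mul_re (k i)] with z h hg hk s hs
    -- Powers of `s` are the form on which the integral operator is diagonal. Since the integral
    -- involves every scale `s ζ`, the formula is needed for all scales at the same `z`.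
    have hφ : ∀ s : ℝ, 0 < s → renormalized f ρ (forest ℂ m) z s =
        ∑ i, ((ρ : ℂ) ^ (-(z * d)) * b i z * (ρ : ℂ) ^ (z * k i)) * (s : ℂ) ^ (-(z * k i)) :=
      fun s hs => by
        rw [h s hs, Finset.mul_sum]
        refine Finset.sum_congr rfl fun i _ => ?_
        rw [exp_log_div hs hρ]
        ring
    rw [forest_singleton_node, hg s hs, (hf.integral_integrand hk hφ hs).2,
      (hf.integral_integrand hk hφ hρ).2, ← Finset.sum_sub_distrib, Fintype.sum_sum_type,
      ← Finset.sum_add_distrib, Finset.mul_sum]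
    refine Finset.sum_congr rfl fun i _ => ?_
    -- The node and the exponent both go up by one, so the extra powers of `ρ` cancel and the new
    -- prefactor is `ρ ^ (-(d + 1) z)`.
    have h1 : (ρ : ℂ) ^ (-(z * d)) * (ρ : ℂ) ^ (z * k i) =
        (ρ : ℂ) ^ (-(z * (d + 1))) * (ρ : ℂ) ^ (z * (k i + 1)) := by
      rw [← Complex.cpow_add _ _ hρ', ← Complex.cpow_add _ _ hρ']
      congr 1
      ring
    have h2 : (ρ : ℂ) ^ (z * (k i + 1)) * (ρ : ℂ) ^ (-(z * (k i + 1))) = 1 := by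
      rw [← Complex.cpow_add _ _ hρ', add_neg_cancel, Complex.cpow_zero]
    simp only [Sum.elim_inl, Sum.elim_inr, Nat.cast_add, Nat.cast_one, Nat.cast_zero, mul_zero,
      Complex.exp_zero, mul_one, exp_log_div hs hρ]
    linear_combination (b i z * mellinIntegral f (z * (k i + 1)) *
      ((s : ℂ) ^ (-(z * (k i + 1))) - (ρ : ℂ) ^ (-(z * (k i + 1))))) * h1 -
      (ρ : ℂ) ^ (-(z * (d + 1))) * b i z * mellinIntegral f (z * (k i + 1)) * h2

/-- The regular family is chosen before `ρ` and `s`, so one polynomial serves all of them; the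
prefactor `ρ ^ (-d z)` is holomorphic with value `1` at `z = 0`. -/
theorem IsAdmissible.exists_physicalLimit_forest {f : ℝ → ℂ} (hf : IsAdmissible f)
    (m : Multiset RTree) : ∃ P : Polynomial ℂ, ∀ ρ s : ℝ, 0 < ρ → 0 < s →
      Tendsto (fun z => renormalized f ρ (forest ℂ m) z s) regulatorLimit
        (𝓝 (P.eval ((Real.log (s / ρ) : ℝ) : ℂ))) ∧
      ExtendsAnalytically fun z => renormalized f ρ (forest ℂ m) z s := by
  obtain ⟨ι, _, b, k, d, hb, h⟩ := hf.exists_regularFamily m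
  obtain ⟨P, hP⟩ := hb.exists_polynomial
  refine ⟨P, fun ρ s hρ hs => ?_⟩
  have hρ' : (ρ : ℂ) ≠ 0 := by exact_mod_cast hρ.ne'
  have h1 : AnalyticAt ℂ (fun z : ℂ => (ρ : ℂ) ^ (-(z * d))) 0 := by
    simp only [Complex.cpow_def_of_ne_zero hρ']
    fun_prop
  have he : ∀ᶠ z in regulatorLimit, renormalized f ρ (forest ℂ m) z s =
      (ρ : ℂ) ^ (-(z * d)) * ∑ i, b i z * Complex.exp (-(Real.log (s / ρ) : ℝ) * (z * k i)) :=
    (h ρ hρ).mono fun z hz => hz s hs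
  refine ⟨?_, ((ExtendsAnalytically.of_analyticAt h1).mul (hb.extendsAnalytically_exp _)).congr he⟩
  have h2 := (h1.continuousAt.tendsto.mono_left regulatorLimit_le).mul (hP (Real.log (s / ρ) : ℝ))
  rw [zero_mul, neg_zero, Complex.cpow_zero, one_mul] at h2
  exact h2.congr' (he.mono fun _ h => h.symm)

end ToyModel

theorem mainTheorem2 (f : ℝ → ℂ) (hf : ToyModel.IsAdmissible f) :
    (∀ x : HR ℂ, ∀ᶠ z in ToyModel.regulatorLimit, ∀ s : ℝ, 0 < s →
      IntegrableOn (ToyModel.integrand f (ToyModel.feynman f x) z s) (Ioi 0)) ∧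
    ∃ Φ : HR ℂ →ₗ[ℂ] Polynomial ℂ, ∀ x : HR ℂ, ∀ ρ s : ℝ, 0 < ρ → 0 < s →
      Tendsto (fun z => ToyModel.renormalized f ρ x z s) ToyModel.regulatorLimit
        (𝓝 ((Φ x).eval ((Real.log (s / ρ) : ℝ) : ℂ))) ∧
      ∃ g : ℂ → ℂ, AnalyticAt ℂ g 0 ∧
        ∀ᶠ z in ToyModel.regulatorLimit, ToyModel.renormalized f ρ x z s = g z := by
  refine ⟨fun x => (hf.feynman_graft x).mono fun z h s hs => (h s hs).1, ?_⟩
  choose P hP using hf.exists_physicalLimit_forest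
  -- Forests form a basis, so the polynomials chosen for them extend linearly, and both assertions
  -- about the limit pass to linear combinations.
  let Φ : HR ℂ →ₗ[ℂ] Polynomial ℂ :=
    (HR.forestBasis ℂ).constr ℂ fun d => P (Finsupp.toMultiset d)
  have hΦ : ∀ m, Φ (HR.forest ℂ m) = P m := fun m => by
    classical
    have h := (HR.forestBasis ℂ).constr_basis ℂ (fun d => P (Finsupp.toMultiset d))
      (Multiset.toFinsupp m)
    rw [HR.forestBasis_apply, Multiset.toFinsupp_toMultiset] at h
    exact h
  refine ⟨Φ, fun x ρ s hρ hs => ?_⟩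
  change _ ∧ ToyModel.ExtendsAnalytically _
  induction x using HR.forest_induction with
  | forest m =>
    rw [hΦ]
    exact hP m ρ s hρ hs
  | add x y hx hy =>
    simp only [map_add, Pi.add_apply, Polynomial.eval_add]
    exact ⟨hx.1.add hy.1, hx.2.add hy.2⟩
  | smul c x hx =>
    simp only [map_smul, Pi.smul_apply, Polynomial.eval_smul, smul_eq_mul]
    exact ⟨hx.1.const_mul c, (ToyModel.ExtendsAnalytically.of_analyticAt analyticAt_const).mul hx.2⟩
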